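/- Write $\epsilon_x=(-1)^x$ and $A_m=\sum_{j=0}^{m-1}(-1)^j t^{m-1-j}$ for $m\ge 0$. For a 3-braid word $\beta$ with writhe (exponent sum) $w=w(\beta)$ let $V_{\widehat\beta}(t)$ be the Jones polynomial of its closure, normalised to be $1$ on the unknot and with $t^{-1}V_{D_+}-tV_{D_-}=(t^{1/2}-t^{-1/2})V_{D_0}$, the generators $\sigma_i$ being positive crossings, and define $V^*_{\widehat\beta}$ by $V_{\widehat\beta}=t^{(w-2)/2}V^*_{\widehat\beta}$. For $\beta=\prod_{j=1}^{r}\sigma_1^{e_{2j-1}}\sigma_2^{e_{2j}}$, a $j$-form of $\beta$ is a product $e_{k_1}e_{k_2}\cdots e_{k_j}$ with $1\le k_1<k_2<\dots<k_j\le 2r$ and $k_i\equiv i+1 \pmod 2$ for all $i$. Let $m_j(\beta,0)$ be the sum of all $j$-forms of $\beta$ (an integer), and $M(\beta,0)=\sum_{k=1}^{r}\epsilon_k\, m_{2k-1}(\beta,0)$. Proposition. Let $\beta=\prod_{j=1}^{r}\sigma_1^{e_{2j-1}}\sigma_2^{e_{2j}}$ be a positive 3-braid word (all $e_k\ge 1$)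 with $r\ge 2$, put $w^*=w(\beta)-e_1$, and suppose $e_1\ge w^*$. Then $$V^*_{\widehat\beta}=B_1(\beta)+t^{w^*+1}G(\beta)+t^{e_1+2}B_2(\beta),\qquad G(\beta)=\epsilon_{w^*}\,M(\beta,0)\,A_{e_1+1-w^*},$$ where $B_1(\beta),B_2(\beta)\in\mathbb{Z}[t]$, $\deg B_1(\beta)\le w^*$ and $\deg B_2(\beta)\le w^*-3$. For fixed $e_2,\dots,e_{2r}$ and $e_1\geq w^*$ varying, $B_1(\beta)$ depends only on the parity of $e_1$, and $B_2(\beta)$ does not depend on $e_1$. Moreover the coefficients of $G(\beta)$, read from the coefficient of $t^{e_1-w^*}$ downwards, do not depend on $e_1$ and all have absolute value $|M(\beta,0)|$, and the gap occupies exactly the $e_1+1-w^*$ places $t^{w^*+1},\dots,t^{e_1+1}$, a number linear in $e_1$. -/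

import Mathlib

open Polynomial LaurentPolynomial

/-- A braid word on `n + 1` strands: a list of letters `(i, s)` standing for the generator
`σ_{i+1}` (which crosses the strands in positions `i` and `i + 1`, counted from `0`) if `s = 1`
and for its inverse if `s = -1`.  The generators `σ_i` are positive crossings. -/
abbrev BraidWord (n : ℕ) : Type := List (Fin n × ℤˣ)

/-- The writhe `w(β)`: the sum of the signs of the crossings. -/
def BraidWord.writhe {n : ℕ} (β : BraidWord n) : ℤ :=
  (β.map fun x => ((x.2 : ℤˣ) : ℤ)).sum

/-- The strand points of the standard diagram of a braid word: `(k, p)` is the point in position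
`p` on the horizontal line just before the letter number `k` (after all letters for the last
`k`). -/
abbrev BraidWord.Point {n : ℕ} (β : BraidWord n) : Type :=
  Fin (β.length + 1) × Fin (n + 1)

/-- The arcs of the diagram of the closure of `β` after all crossings have been smoothed according
to the state `s`.  At the letter number `k` the value `s k = true` means the smoothing that respects
the orientation (two vertical arcs), and `s k = false` means the other one (a cup and a cap). -/
inductive BraidWord.Joined {n : ℕ} (β : BraidWord n) (s : Fin β.length → Bool) :
    β.Point → β.Point → Prop
  /-- a strand that takes no part in the crossing runs straight on -/
  | pass (k : Fin β.length) (p : Fin (n + 1)) :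
      p ≠ (β.get k).1.castSucc → p ≠ (β.get k).1.succ →
      Joined β s (k.castSucc, p) (k.succ, p)
  /-- oriented smoothing, left arc -/
  | left (k : Fin β.length) : s k = true →
      Joined β s (k.castSucc, (β.get k).1.castSucc) (k.succ, (β.get k).1.castSucc)
  /-- oriented smoothing, right arc -/
  | right (k : Fin β.length) : s k = true →
      Joined β s (k.castSucc, (β.get k).1.succ) (k.succ, (β.get k).1.succ)
  /-- the other smoothing, arc joining the two incoming ends -/
  | incoming (k : Fin β.length) : s k = false →
      Joined β s (k.castSucc, (β.get k).1.castSucc) (k.castSucc, (β.get k).1.succ)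
  /-- the other smoothing, arc joining the two outgoing ends -/
  | outgoing (k : Fin β.length) : s k = false →
      Joined β s (k.succ, (β.get k).1.castSucc) (k.succ, (β.get k).1.succ)
  /-- the closing arcs of the standard closure -/
  | close (p : Fin (n + 1)) : Joined β s (Fin.last _, p) (0, p)

/-- The number of closed curves of the state `s` of the closure of `β`. -/
noncomputable def BraidWord.loops {n : ℕ} (β : BraidWord n) (s : Fin β.length → Bool) : ℕ :=
  Nat.card (Quot (BraidWord.Joined β s))

/-- The exponent of `A` contributed by a state: the `A`-smoothing is the oriented smoothing of a
positive crossing and the other smoothing of a negative crossing. -/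
def BraidWord.stateExponent {n : ℕ} (β : BraidWord n) (s : Fin β.length → Bool) : ℤ :=
  ∑ k, if s k then (((β.get k).2 : ℤˣ) : ℤ) else -(((β.get k).2 : ℤˣ) : ℤ)

/-- The Kauffman bracket of the diagram of the closure of `β`, as a Laurent polynomial in `A = T 1`,
with value `1` on a circle and `-A² - A⁻²` for each further circle. -/
noncomputable def BraidWord.kauffmanBracket {n : ℕ} (β : BraidWord n) : ℤ[T;T⁻¹] :=
  ∑ s : Fin β.length → Bool,
    T (β.stateExponent s) * (-T 2 - T (-2)) ^ (β.loops s - 1)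

/-- The Jones polynomial `V` of the closure of `β`, namely `(-A³)^{-w}` times the Kauffman bracket.
It is written as a Laurent polynomial in `A = T 1`, where `t = A⁻⁴`: so `t` is `T (-4)` and `t^{1/2}`
is `T (-2)`. -/
noncomputable def BraidWord.jones {n : ℕ} (β : BraidWord n) : ℤ[T;T⁻¹] :=
  LaurentPolynomial.C ((β.writhe.negOnePow : ℤˣ) : ℤ) * T (-3 * β.writhe) * β.kauffmanBracket

/-- The substitution of `t = A⁻⁴` into an integer polynomial in `t`. -/
noncomputable def inT (f : ℤ[X]) : ℤ[T;T⁻¹] := Polynomial.aeval (T (-4)) f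

/-- The normalised Jones polynomial `V*` of the closure of a 3-braid word, determined by
`V = t^{(w-2)/2} V*`. -/
noncomputable def BraidWord.vStar (β : BraidWord 2) : ℤ[T;T⁻¹] :=
  T (2 * (β.writhe - 2)) * β.jones

/-- The positive 3-braid word `∏_{j=1}^{r} σ₁^{e_{2j-1}} σ₂^{e_{2j}}`; only the values `e 1`, …,
`e (2 * r)` matter. -/
def threeBraid (r : ℕ) (e : ℕ → ℕ) : BraidWord 2 :=
  (List.range r).flatMap fun j =>
    List.replicate (e (2 * j + 1)) (0, 1) ++ List.replicate (e (2 * j + 2)) (1, 1)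

/-- `w* = w(β) - e₁`, the sum of all exponents but the first. -/
def wStar (r : ℕ) (e : ℕ → ℕ) : ℕ := ∑ k ∈ Finset.Icc 2 (2 * r), e k

theorem writhe_threeBraid (r : ℕ) (hr : 1 ≤ r) (e : ℕ → ℕ) :
    (threeBraid r e).writhe - (e 1 : ℤ) = (wStar r e : ℤ) := by
  induction r, hr using Nat.le_induction with
  | base => simp [threeBraid, wStar, BraidWord.writhe]
  | succ r hr ih =>
    have h1 : (threeBraid (r + 1) e).writhe
        = (threeBraid r e).writhe + e (2 * r + 1) + e (2 * r + 2) := by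
      simp [threeBraid, BraidWord.writhe, List.range_succ, add_assoc]
    have h2 : wStar (r + 1) e = wStar r e + e (2 * r + 1) + e (2 * r + 2) := by
      unfold wStar
      rw [show 2 * (r + 1) = 2 * r + 1 + 1 by ring, Finset.sum_Icc_succ_top (by omega),
        Finset.sum_Icc_succ_top (by omega)]
    rw [h1, h2]
    push_cast
    linarith

/-- `A_m = ∑_{j=0}^{m-1} (-1)^j t^{m-1-j}`. -/
noncomputable def altPoly (m : ℕ) : ℤ[X] :=
  ∑ j ∈ Finset.range m, (-1) ^ j * X ^ (m - 1 - j)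

open Classical in
/-- The sum `m_j(β, 0)` of all `j`-forms of the word with exponents `e₁, …, e_{2r}`: a `j`-form is a
product `e_{k_1} ⋯ e_{k_j}` with `1 ≤ k_1 < ⋯ < k_j ≤ 2r` and `k_i ≡ i + 1` modulo `2`.  (The
index `i` runs from `0` here.) -/
noncomputable def formSum (r : ℕ) (e : ℕ → ℕ) (j : ℕ) : ℤ :=
  ∑ k ∈ (Fintype.piFinset fun _ : Fin j => Finset.Icc 1 (2 * r)) with
      StrictMono k ∧ ∀ i : Fin j, k i ≡ (i : ℕ) + 2 [MOD 2],
    ∏ i, (e (k i) : ℤ)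

/-- The alternating sum `M(β, 0) = ∑_{k=1}^{r} (-1)^k m_{2k-1}(β, 0)`. -/
noncomputable def altFormSum (r : ℕ) (e : ℕ → ℕ) : ℤ :=
  ∑ k ∈ Finset.Icc 1 r, (-1) ^ k * formSum r e (2 * k - 1)

/-- The inter-block gap `G(β) = (-1)^{w*} M(β, 0) A_{e₁ + 1 - w*}` (used when `e₁ ≥ w*`). -/
noncomputable def gapPoly (r : ℕ) (e : ℕ → ℕ) : ℤ[X] :=
  Polynomial.C ((-1) ^ wStar r e * altFormSum r e) * altPoly (e 1 + 1 - wStar r e)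

/-! For a positive word the normalised polynomial is `V* = (-1)^w (t tr ψ(β) + t² + 1)`, with `ψ`
the reduced Burau representation (`vStar_of_positive`). To get this from the state sum, the loops of
a state are counted by two-colourings. This is a Temperley-Lieb representation at loop value 2, and
its exponents transfer to a two-dimensional representation at loop value `-A² - A⁻²`.

The exponent `e₁ = a` enters only through the left factor `ψ(σ₁)^a = [[(-t)^a, g_a], [0, 1]]`, where
`(1+t) g_a = 1 - (-t)^a`. If `Q` is the matrix of the remaining word, the trace is `(-t)^a Q₀₀ + g_a
Q₁₀ + Q₁₁`. Put `R = Q₁₀(-1)` and write `Q₁₀ = (1+t)v - Rt`. The multiple of `1+t` gives only `v -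
(-t)^a v`, a low and a high block. The term `-R t g_a` is a geometric sum: its first `w* - 1` terms
join the low block and the rest are the gap. The high block is `Q₀₀ - v`, and degree bounds on the
rows of `Q` keep the blocks apart.

At `t = -1` the generators become transvections, whose products generate alternating forms, so `R =
M(β, 0)` (`altFormSum_eq_eval_burau`). -/

/-! ### Counting the loops of a state by two-colourings. -/

/-- The transfer matrix, on two-colourings of three points, of the cup-cap diagram that joins the
positions `i` and `i + 1` on both sides. -/
def cupCap (i : Fin 2) : Matrix (Fin 3 → Bool) (Fin 3 → Bool) ℤ := fun x y =>
  if x i.castSucc = x i.succ ∧ y i.castSucc = y i.succ ∧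
    ∀ p, p ≠ i.castSucc → p ≠ i.succ → x p = y p then 1 else 0

theorem cupCap_mul_self : ∀ i, cupCap i * cupCap i = (2 : ℤ) • cupCap i := by
  decide +kernel

theorem cupCap_mul_mul : ∀ i j, i ≠ j → cupCap i * cupCap j * cupCap i = cupCap i := by
  decide +kernel

theorem trace_cupCap (i : Fin 2) : (cupCap i).trace = 4 := by
  revert i
  decide +kernel

theorem trace_cupCap_mul (i j : Fin 2) (h : i ≠ j) : (cupCap i * cupCap j).trace = 2 := by
  fin_cases i <;> fin_cases j <;> first | exact absurd rfl h | decide +kernel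

/-- An entry of a product of matrices is a sum over paths. -/
theorem list_ofFn_prod_apply {S R : Type*} [Fintype S] [DecidableEq S] [CommRing R] {L : ℕ}
    (M : Fin L → Matrix S S R) (a b : S) :
    (List.ofFn M).prod a b = ∑ x : Fin (L + 1) → S,
      if x 0 = a ∧ x (Fin.last L) = b then ∏ k, M k (x k.castSucc) (x k.succ) else 0 := by
  induction L generalizing a with
  | zero =>
    rw [← (Equiv.funUnique (Fin 1) S).symm.sum_comp]
    simp [Matrix.one_apply, ite_and, Finset.sum_ite_eq']
  | succ L ih =>
    rw [List.ofFn_succ, List.prod_cons, Matrix.mul_apply,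
      ← (Fin.consEquiv fun _ : Fin (L + 2) => S).sum_comp, Fintype.sum_prod_type]
    simp only [Fin.consEquiv_apply, Fin.cons_zero, Fin.prod_univ_succ, Fin.castSucc_zero,
      ← Fin.succ_last, Fin.cons_succ, ← Fin.succ_castSucc, ite_and]
    refine Eq.trans ?_ (Fintype.sum_eq_single a fun c hc => by simp [hc]).symm
    simp only [ih, Finset.mul_sum, ite_and]
    rw [Finset.sum_comm]
    refine Finset.sum_congr rfl fun x _ => ?_
    simp

theorem trace_list_ofFn_prod {S R : Type*} [Fintype S] [DecidableEq S] [CommRing R] {L : ℕ}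
    (M : Fin L → Matrix S S R) :
    (List.ofFn M).prod.trace = ∑ x : Fin (L + 1) → S,
      if x (Fin.last L) = x 0 then ∏ k, M k (x k.castSucc) (x k.succ) else 0 := by
  simp only [Matrix.trace, Matrix.diag_apply, list_ofFn_prod_apply, ite_and]
  rw [Finset.sum_comm]
  refine Finset.sum_congr rfl fun x _ => ?_
  simp

/-- The functions on a quotient are the functions on the whole that respect the relation. -/
def quotArrowEquiv {α : Type*} (r : α → α → Prop) (β : Type*) :
    (Quot r → β) ≃ {f : α → β // ∀ a b, r a b → f a = f b} where
  toFun g := ⟨fun a => g (Quot.mk r a), fun a b h => congrArg g (Quot.sound h)⟩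
  invFun f := Quot.lift f.1 f.2
  left_inv g := by
    ext q
    induction q using Quot.ind
    rfl
  right_inv f := rfl

namespace BraidWord

/-- The letters of the Temperley-Lieb word of a state; `none` stands for an oriented smoothing. -/
def stateWord {n : ℕ} (β : BraidWord n) (s : Fin β.length → Bool) : List (Option (Fin n)) :=
  List.ofFn fun k => if s k then none else some (β.get k).1

/-- Apart from the closing arcs, every arc lies in one horizontal slice, so being constant on loops
is a slice-by-slice condition, recorded by an entry of a transfer matrix. -/
theorem joined_respects_iff (β : BraidWord 2) (s : Fin β.length → Bool) (f : β.Point → Bool) :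
    (∀ a b, Joined β s a b → f a = f b) ↔
      (∀ p, f (Fin.last _, p) = f (0, p)) ∧ ∀ k : Fin β.length,
        ((if s k then none else some (β.get k).1 : Option (Fin 2)).elim 1 cupCap)
          (fun p => f (k.castSucc, p)) (fun p => f (k.succ, p)) = 1 := by
  constructor
  · intro h
    refine ⟨fun p => h _ _ (.close p), fun k => ?_⟩
    cases hs : s k
    · have h1 := h _ _ (.incoming k hs)
      have h2 := h _ _ (.outgoing k hs)
      simp only [Bool.false_eq_true, if_false, Option.elim_some, cupCap]
      rw [if_pos ⟨h1, h2, fun p hp hq => h _ _ (.pass k p hp hq)⟩]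
    · simp only [if_true, Option.elim_none, Matrix.one_apply]
      rw [if_pos]
      ext p
      by_cases hp : p = (β.get k).1.castSucc
      · subst hp; exact h _ _ (.left k hs)
      by_cases hq : p = (β.get k).1.succ
      · subst hq; exact h _ _ (.right k hs)
      exact h _ _ (.pass k p hp hq)
  · rintro ⟨hc, hk⟩ a b hab
    have hfalse : ∀ k, s k = false →
        f (k.castSucc, (β.get k).1.castSucc) = f (k.castSucc, (β.get k).1.succ) ∧
        f (k.succ, (β.get k).1.castSucc) = f (k.succ, (β.get k).1.succ) ∧
        ∀ p, p ≠ (β.get k).1.castSucc → p ≠ (β.get k).1.succ →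
          f (k.castSucc, p) = f (k.succ, p) := by
      intro k hs
      have := hk k
      simp only [hs, Bool.false_eq_true, if_false, Option.elim_some, cupCap] at this
      by_contra hcon
      rw [if_neg hcon] at this
      exact zero_ne_one this
    have htrue : ∀ k, s k = true → ∀ p, f (k.castSucc, p) = f (k.succ, p) := by
      intro k hs
      have := hk k
      simp only [hs, if_true, Option.elim_none, Matrix.one_apply] at this
      by_contra hcon
      rw [if_neg (fun h => hcon (congrFun h))] at this
      exact zero_ne_one this
    cases hab with
    | pass k p hp hq =>
      cases hs : s k
      · exact (hfalse k hs).2.2 p hp hq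
      · exact htrue k hs p
    | left k hs => exact htrue k hs _
    | right k hs => exact htrue k hs _
    | incoming k hs => exact (hfalse k hs).1
    | outgoing k hs => exact (hfalse k hs).2.1
    | close p => exact hc p

/-- Both sides count the colourings of the strand points by `Bool` that are constant on loops:
choose a colour for each loop, or sum over closed paths of slices. -/
theorem two_pow_loops (β : BraidWord 2) (s : Fin β.length → Bool) :
    (2 : ℤ) ^ β.loops s = ((β.stateWord s).map fun o : Option (Fin 2) => o.elim 1 cupCap).prod.trace := by
  classical
  have h01 : ∀ (o : Option (Fin 2)) x y, (o.elim 1 cupCap) x y = 0 ∨ (o.elim 1 cupCap) x y = 1 := by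
    rintro (_ | i) x y
    · by_cases h : x = y <;> simp [h]
    · simp only [Option.elim_some, cupCap]
      split_ifs <;> simp
  have hcard : 2 ^ β.loops s = Nat.card {f : β.Point → Bool // ∀ a b, Joined β s a b → f a = f b} := by
    rw [← Nat.card_congr (quotArrowEquiv _ Bool), Nat.card_fun]
    simp [loops]
  have h2 : Nat.card {f : β.Point → Bool // ∀ a b, Joined β s a b → f a = f b} =
      Nat.card {x : Fin (β.length + 1) → Fin 3 → Bool // x (Fin.last _) = x 0 ∧
        ∀ k : Fin β.length, ((if s k then none else some (β.get k).1 : Option (Fin 2)).elim 1 cupCap)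
          (x k.castSucc) (x k.succ) = 1} := by
    refine Nat.card_congr ((Equiv.curry _ _ _).subtypeEquiv fun f => ?_)
    rw [joined_respects_iff]
    exact and_congr_left' funext_iff.symm
  rw [stateWord, List.map_ofFn, trace_list_ofFn_prod]
  have h3 := hcard.trans h2
  rw [Nat.card_eq_fintype_card, Fintype.card_subtype] at h3
  rw [← Nat.cast_ofNat, ← Nat.cast_pow, h3, Finset.card_filter, Nat.cast_sum]
  refine Finset.sum_congr rfl fun x _ => ?_
  rw [ite_and]
  simp only [Function.comp_apply]
  split_ifs with hx hk
  · rw [Finset.prod_eq_one fun k _ => hk k]; rfl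
  · push Not at hk
    obtain ⟨k, hk⟩ := hk
    rw [Finset.prod_eq_zero (Finset.mem_univ k) ((h01 _ _ _).resolve_right hk)]; rfl
  · rfl

end BraidWord

/-! ### Temperley-Lieb words and their traces. -/

/-- Every word in the generators of the Temperley-Lieb algebra on three strands is a power of the
loop value times one of the five reduced words. -/
theorem temperleyLieb_normalForm (w : List (Option (Fin 2))) :
    (∀ o ∈ w, o = none) ∨ (¬ ∀ o ∈ w, o = none) ∧ ∃ (c : ℕ) (i j : Fin 2) (b : Bool), i ≠ j ∧
      ∀ {R A : Type} [CommRing R] [Ring A] [Algebra R A] (x : R) (E : Fin 2 → A),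
        (∀ i, E i * E i = x • E i) → (∀ i j, i ≠ j → E i * E j * E i = E i) →
        (w.map fun o : Option (Fin 2) => o.elim 1 E).prod = x ^ c • (if b then E i else E i * E j) := by
  induction w with
  | nil => simp
  | cons o w ih =>
    rcases o with _ | l
    · rcases ih with h | ⟨h, c, i, j, b, hij, H⟩
      · exact .inl (by simpa using h)
      · exact .inr ⟨by simpa using h, c, i, j, b, hij, fun x E h1 h2 => by
          simpa using H x E h1 h2⟩
    · right
      refine ⟨by simp, ?_⟩
      rcases ih with h | ⟨h, c, i, j, b, hij, H⟩
      · obtain ⟨m, hm⟩ := exists_ne l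
        refine ⟨0, l, m, true, hm.symm, fun x E h1 h2 => ?_⟩
        have : (w.map fun o : Option (Fin 2) => o.elim 1 E).prod = 1 :=
          List.prod_eq_one (by
            intro y hy
            obtain ⟨o, ho, rfl⟩ := List.mem_map.1 hy
            rw [h o ho]; rfl)
        simp [this]
      -- Multiplying on the left by the leading letter closes a loop; the other letter either
      -- lengthens `E i` to `E l * E i` or contracts `E l * E i * E l` to `E l`.
      · by_cases hl : l = i
        · subst hl
          refine ⟨c + 1, l, j, b, hij, fun x E h1 h2 => ?_⟩
          rw [List.map_cons, List.prod_cons, H x E h1 h2, Option.elim_some, mul_smul_comm, pow_succ,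
            mul_smul]
          cases b <;> simp [← mul_assoc, h1]
        · have hl' : l = j := by omega
          subst hl'
          cases b
          · refine ⟨c, l, i, true, hl, fun x E h1 h2 => ?_⟩
            rw [List.map_cons, List.prod_cons, H x E h1 h2, Option.elim_some, mul_smul_comm]
            simp [← mul_assoc, h2 l i hl]
          · refine ⟨c, l, i, false, hl, fun x E h1 h2 => ?_⟩
            rw [List.map_cons, List.prod_cons, H x E h1 h2, Option.elim_some, mul_smul_comm]
            simp

/-- A two-dimensional representation of the Temperley-Lieb algebra on three strands computes the
number of loops of every state. -/
theorem BraidWord.pow_loops_sub_one {R : Type} [CommRing R] (β : BraidWord 2)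
    (s : Fin β.length → Bool) (x : R) (E : Fin 2 → Matrix (Fin 2) (Fin 2) R)
    (h1 : ∀ i, E i * E i = x • E i) (h2 : ∀ i j, i ≠ j → E i * E j * E i = E i)
    (t1 : ∀ i, (E i).trace = x) (t2 : ∀ i j, i ≠ j → (E i * E j).trace = 1) :
    x ^ (β.loops s - 1) = ((β.stateWord s).map fun o : Option (Fin 2) => o.elim 1 E).prod.trace +
      if ∀ k, s k = true then x ^ 2 - 2 else 0 := by
  have hall : (∀ o ∈ β.stateWord s, o = none) ↔ ∀ k, s k = true := by
    simp [stateWord, List.mem_ofFn]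
  have hl := β.two_pow_loops s
  rcases temperleyLieb_normalForm (β.stateWord s) with h | ⟨h, c, i, j, b, hij, H⟩
  · have hone : ∀ {A : Type} [Ring A] (E : Fin 2 → A),
        ((β.stateWord s).map fun o : Option (Fin 2) => o.elim 1 E).prod = 1 := fun E =>
      List.prod_eq_one (by
        intro y hy
        obtain ⟨o, ho, rfl⟩ := List.mem_map.1 hy
        rw [h o ho]; rfl)
    rw [hone, Matrix.trace_one] at hl
    have : β.loops s = 3 := by
      refine Int.pow_right_injective (a := 2) (by norm_num) ?_
      simpa using hl
    rw [if_pos (hall.1 h), hone, Matrix.trace_one, this]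
    simp
  -- The exponent `c` depends on the word alone, so the colouring representation determines it from
  -- the number of loops, and it can then be used for `E`.
  · rw [H (2 : ℤ) cupCap cupCap_mul_self cupCap_mul_mul] at hl
    rw [if_neg (fun hs => h (hall.2 hs)), H x E h1 h2, add_zero]
    cases b
    · rw [Matrix.trace_smul, smul_eq_mul] at hl
      have : β.loops s = c + 1 := by
        refine Int.pow_right_injective (a := 2) (by norm_num) ?_
        simpa [trace_cupCap_mul i j hij, pow_succ] using hl
      simp [this, t2 i j hij]
    · rw [Matrix.trace_smul, smul_eq_mul] at hl
      have : β.loops s = c + 2 := by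
        refine Int.pow_right_injective (a := 2) (by norm_num) ?_
        simpa [trace_cupCap, pow_add] using hl
      simp [this, t1, pow_succ]

/-- Expansion of a product of sums of two terms over all choices of a term. -/
theorem list_ofFn_prod_add {R A : Type*} [CommRing R] [Ring A] [Algebra R A] {L : ℕ}
    (a b : Fin L → R) (E : Fin L → A) :
    (List.ofFn fun k => a k • (1 : A) + b k • E k).prod =
      ∑ s : Fin L → Bool, (∏ k, if s k then a k else b k) •
        (List.ofFn fun k => if s k then 1 else E k).prod := by
  induction L with
  | zero => simp
  | succ L ih =>
    rw [List.ofFn_succ, List.prod_cons, ih,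
      ← (Fin.consEquiv fun _ : Fin (L + 1) => Bool).sum_comp, Fintype.sum_prod_type]
    simp only [Fin.consEquiv_apply, Fintype.sum_bool, Fin.prod_univ_succ, List.ofFn_succ,
      Fin.cons_zero, Fin.cons_succ, List.prod_cons, if_true, Bool.false_eq_true, if_false,
      add_mul, Finset.mul_sum, one_mul, smul_mul_smul_comm]
    simp only [mul_smul, Finset.sum_add_distrib]

theorem LaurentPolynomial.T_sum {ι : Type*} (s : Finset ι) (f : ι → ℤ) :
    (T (∑ i ∈ s, f i) : ℤ[T;T⁻¹]) = ∏ i ∈ s, T (f i) := by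
  classical
  induction s using Finset.induction_on with
  | empty => simp
  | insert i s hi ih => rw [Finset.sum_insert hi, Finset.prod_insert hi, T_add, ih]

/-! ### The Jones polynomial as a Burau trace. -/

/-- The two-dimensional representation of the Temperley-Lieb algebra on three strands, in a basis in
which the reduced Burau matrices are polynomial in `t`. -/
noncomputable def tlMatrix (i : Fin 2) : Matrix (Fin 2) (Fin 2) ℤ[T;T⁻¹] :=
  if i = 0 then !![-T 2 - T (-2), T 2; 0, 0] else !![0, 0; T (-2), -T 2 - T (-2)]

theorem T_two_mul_T_neg_two : (T 2 * T (-2) : ℤ[T;T⁻¹]) = 1 := by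
  rw [← T_add]; simp

theorem tlMatrix_mul_self (i : Fin 2) :
    tlMatrix i * tlMatrix i = (-T 2 - T (-2) : ℤ[T;T⁻¹]) • tlMatrix i := by
  fin_cases i <;> ext a b <;> fin_cases a <;> fin_cases b <;>
    simp [tlMatrix, Matrix.mul_apply, Fin.sum_univ_two]

theorem tlMatrix_mul_mul (i j : Fin 2) (h : i ≠ j) :
    tlMatrix i * tlMatrix j * tlMatrix i = tlMatrix i := by
  have key : ∀ {R : Type} [CommRing R] (x u v : R), u * v = 1 →
      !![x, u; 0, 0] * !![0, 0; v, x] * !![x, u; 0, 0] = !![x, u; 0, 0] ∧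
      !![0, 0; v, x] * !![x, u; 0, 0] * !![0, 0; v, x] = !![0, 0; v, x] := by
    intro R _ x u v huv
    have hvu : v * u = 1 := by rw [mul_comm, huv]
    constructor <;> rw [Matrix.mul_fin_two, Matrix.mul_fin_two] <;>
      simp only [mul_zero, zero_mul, add_zero, zero_add, huv, hvu, one_mul]
  have h01 : tlMatrix 0 * tlMatrix 1 * tlMatrix 0 = tlMatrix 0 :=
    (key _ _ _ T_two_mul_T_neg_two).1
  have h10 : tlMatrix 1 * tlMatrix 0 * tlMatrix 1 = tlMatrix 1 :=
    (key _ _ _ T_two_mul_T_neg_two).2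
  match i, j, h with
  | 0, 0, h => exact absurd rfl h
  | 1, 1, h => exact absurd rfl h
  | 0, 1, _ => exact h01
  | 1, 0, _ => exact h10

theorem trace_tlMatrix (i : Fin 2) : (tlMatrix i).trace = -T 2 - T (-2) := by
  fin_cases i <;> simp [tlMatrix, Matrix.trace_fin_two]

theorem trace_tlMatrix_mul (i j : Fin 2) (h : i ≠ j) : (tlMatrix i * tlMatrix j).trace = 1 := by
  have h01 : (tlMatrix 0 * tlMatrix 1).trace = 1 := by
    rw [tlMatrix, tlMatrix, if_pos rfl, if_neg (by decide), Matrix.mul_fin_two,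
      Matrix.trace_fin_two_of]
    linear_combination T_two_mul_T_neg_two
  match i, j, h with
  | 0, 0, h => exact absurd rfl h
  | 1, 1, h => exact absurd rfl h
  | 0, 1, _ => exact h01
  | 1, 0, _ => exact (Matrix.trace_mul_comm _ _).trans h01

namespace BraidWord

theorem kauffmanBracket_eq_trace (β : BraidWord 2) :
    β.kauffmanBracket =
      (β.map fun x => (T ((x.2 : ℤˣ) : ℤ) : ℤ[T;T⁻¹]) • (1 : Matrix (Fin 2) (Fin 2) ℤ[T;T⁻¹]) +
        (T (-((x.2 : ℤˣ) : ℤ)) : ℤ[T;T⁻¹]) • tlMatrix x.1).prod.trace +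
      T β.writhe * ((-T 2 - T (-2)) ^ 2 - 2) := by
  have hw : β.writhe = ∑ k : Fin β.length, (((β.get k).2 : ℤˣ) : ℤ) := by
    rw [writhe, ← List.sum_ofFn]
    congr 1
    conv_lhs => rw [← List.ofFn_get β, List.map_ofFn]
    rfl
  have hmap : (β.map fun x => (T ((x.2 : ℤˣ) : ℤ) : ℤ[T;T⁻¹]) • (1 : Matrix (Fin 2) (Fin 2) ℤ[T;T⁻¹]) +
        (T (-((x.2 : ℤˣ) : ℤ)) : ℤ[T;T⁻¹]) • tlMatrix x.1) = List.ofFn fun k : Fin β.length =>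
          (T (((β.get k).2 : ℤˣ) : ℤ) : ℤ[T;T⁻¹]) • (1 : Matrix (Fin 2) (Fin 2) ℤ[T;T⁻¹]) +
            (T (-(((β.get k).2 : ℤˣ) : ℤ)) : ℤ[T;T⁻¹]) • tlMatrix (β.get k).1 := by
    conv_lhs => rw [← List.ofFn_get β, List.map_ofFn]
    rfl
  rw [hmap, list_ofFn_prod_add, Matrix.trace_sum, kauffmanBracket]
  simp only [β.pow_loops_sub_one _ _ tlMatrix tlMatrix_mul_self tlMatrix_mul_mul trace_tlMatrix
    trace_tlMatrix_mul, mul_add, Finset.sum_add_distrib, mul_ite, mul_zero]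
  congr 1
  · refine Finset.sum_congr rfl fun s _ => ?_
    rw [Matrix.trace_smul, smul_eq_mul, stateExponent, LaurentPolynomial.T_sum, stateWord,
      List.map_ofFn]
    congr 1
    · exact Finset.prod_congr rfl fun k _ => by split_ifs <;> rfl
    · congr 3
      funext k
      cases h : s k <;> simp [h]
  -- Only the fully oriented state needs a correction: it has three loops, whereas the identity has
  -- trace 2 instead of `x ^ 2`.
  · rw [Finset.sum_eq_single (fun _ => true)]
    · simp [stateExponent, hw]
    · intro s _ hs
      rw [if_neg (fun h => hs (funext h))]
    · simp

/-- The reduced Burau matrices of the generators of the braid group on three strands. -/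
noncomputable def burauGen (i : Fin 2) : Matrix (Fin 2) (Fin 2) ℤ[X] :=
  if i = 0 then !![-X, 1; 0, 1] else !![1, 0; X, -X]

/-- The reduced Burau matrix of a positive 3-braid word. -/
noncomputable def burau (β : BraidWord 2) : Matrix (Fin 2) (Fin 2) ℤ[X] :=
  (β.map fun x => burauGen x.1).prod

/-- The unequal off-diagonal entries `T 2` and `T (-2)` of `tlMatrix` are chosen so that, after
extracting `A`, only powers of `t = A⁻⁴` remain. -/
theorem T_smul_add_tlMatrix (i : Fin 2) :
    ((T 1 : ℤ[T;T⁻¹]) • (1 : Matrix (Fin 2) (Fin 2) ℤ[T;T⁻¹]) + (T (-1) : ℤ[T;T⁻¹]) • tlMatrix i) =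
      (T 1 : ℤ[T;T⁻¹]) • (burauGen i).map (Polynomial.aeval (R := ℤ) (T (-4) : ℤ[T;T⁻¹])) := by
  have h1 : (T (-1) * T 2 : ℤ[T;T⁻¹]) = T 1 := by rw [← T_add]; rfl
  have h2 : (T (-1) * T (-2) : ℤ[T;T⁻¹]) = T 1 * T (-4) := by rw [← T_add, ← T_add]; rfl
  have h3 : (T 1 + T (-1) * (-T 2 - T (-2)) : ℤ[T;T⁻¹]) = T 1 * -T (-4) := by
    linear_combination -h1 - h2
  have map_of : ∀ a b c d : ℤ[X],
      (!![a, b; c, d]).map (Polynomial.aeval (R := ℤ) (T (-4) : ℤ[T;T⁻¹])) =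
        !![aeval (T (-4)) a, aeval (T (-4)) b; aeval (T (-4)) c, aeval (T (-4)) d] :=
    fun a b c d => by ext a b; fin_cases a <;> fin_cases b <;> rfl
  match i with
  | 0 =>
    rw [tlMatrix, burauGen, if_pos rfl, if_pos rfl, map_of, Matrix.one_fin_two]
    simp only [Matrix.smul_of, Matrix.smul_cons, Matrix.smul_empty, Matrix.of_add_of,
      Matrix.add_cons, Matrix.head_cons, Matrix.tail_cons, Matrix.empty_add_empty, smul_eq_mul,
      mul_one, mul_zero, zero_add, add_zero, h1, h3, map_neg, map_one, map_zero, aeval_X]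
  | 1 =>
    rw [tlMatrix, burauGen, if_neg (by decide), if_neg (by decide), map_of, Matrix.one_fin_two]
    simp only [Matrix.smul_of, Matrix.smul_cons, Matrix.smul_empty, Matrix.of_add_of,
      Matrix.add_cons, Matrix.head_cons, Matrix.tail_cons, Matrix.empty_add_empty, smul_eq_mul,
      mul_one, mul_zero, zero_add, add_zero, h2, h3, map_neg, map_one, map_zero, aeval_X]

theorem prod_T_smul_add_tlMatrix (β : BraidWord 2) (hβ : ∀ x ∈ β, x.2 = 1) :
    (β.map fun x => (T ((x.2 : ℤˣ) : ℤ) : ℤ[T;T⁻¹]) • (1 : Matrix (Fin 2) (Fin 2) ℤ[T;T⁻¹]) +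
        (T (-((x.2 : ℤˣ) : ℤ)) : ℤ[T;T⁻¹]) • tlMatrix x.1).prod =
      (T (β.length : ℤ) : ℤ[T;T⁻¹]) • β.burau.map (Polynomial.aeval (R := ℤ) (T (-4) : ℤ[T;T⁻¹])) := by
  induction β with
  | nil => simp [burau]
  | cons x β ih =>
    have hx : x.2 = 1 := hβ x (by simp)
    rw [List.map_cons, List.prod_cons, ih fun y hy => hβ y (by simp [hy]), hx, Units.val_one,
      T_smul_add_tlMatrix, smul_mul_smul_comm, ← T_add, burau, burau, List.map_cons, List.prod_cons]
    congr 1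
    · rw [List.length_cons]; push_cast; rw [add_comm]
    · ext1 a b
      simp [Matrix.mul_apply]

theorem writhe_of_positive {n : ℕ} (β : BraidWord n) (hβ : ∀ x ∈ β, x.2 = 1) :
    β.writhe = β.length := by
  rw [writhe, List.map_congr_left (g := fun _ => (1 : ℤ)) (by
    intro x hx; rw [hβ x hx]; rfl)]
  simp

theorem vStar_of_positive (β : BraidWord 2) (hβ : ∀ x ∈ β, x.2 = 1) :
    β.vStar = inT ((-1) ^ β.length * (X * β.burau.trace + X ^ 2 + 1)) := by
  have htr : (β.burau.map (Polynomial.aeval (R := ℤ) (T (-4) : ℤ[T;T⁻¹]))).trace =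
      inT β.burau.trace := by
    simp [Matrix.trace, inT]
  have hsign : ((Int.negOnePow (β.length : ℤ) : ℤˣ) : ℤ) = (-1) ^ β.length := by
    simp [Int.negOnePow_def]
  rw [vStar, jones, kauffmanBracket_eq_trace, prod_T_smul_add_tlMatrix β hβ,
    writhe_of_positive β hβ, Matrix.trace_smul, htr, hsign, smul_eq_mul]
  have e1 : (T (2 * ((β.length : ℤ) - 2)) * T (-3 * (β.length : ℤ)) * T (β.length : ℤ) : ℤ[T;T⁻¹])
      = T (-4) := by
    rw [← T_add, ← T_add]; congr 1; ring
  have e2 : ((-T 2 - T (-2)) ^ 2 - 2 : ℤ[T;T⁻¹]) = T 4 + T (-4) := by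
    have h4 : (T 4 : ℤ[T;T⁻¹]) = T 2 * T 2 := by rw [← T_add]; rfl
    have h5 : (T (-4) : ℤ[T;T⁻¹]) = T (-2) * T (-2) := by rw [← T_add]; rfl
    rw [h4, h5]
    linear_combination 2 * T_two_mul_T_neg_two
  have e3 : (T 4 * T (-4) : ℤ[T;T⁻¹]) = 1 := by rw [← T_add]; simp
  have e4 : inT ((-1) ^ β.length * (X * β.burau.trace + X ^ 2 + 1)) =
      (-1) ^ β.length * (T (-4) * inT β.burau.trace + T (-4) ^ 2 + 1) := by
    simp only [inT, map_mul, map_add, map_pow, map_neg, map_one, aeval_X]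
  rw [e4, e2, map_pow, map_neg, map_one]
  linear_combination ((-1) ^ β.length * (inT β.burau.trace + T 4 + T (-4))) * e1
    + (-1) ^ β.length * e3

end BraidWord

/-! ### Recursions for alternating forms. -/

open Classical in
/-- The sum of all alternating products of `j` of the numbers `e 1, …, e N`, the first index being
even. -/
noncomputable def altForms (e : ℕ → ℕ) (N j : ℕ) : ℤ :=
  ∑ k ∈ (Fintype.piFinset fun _ : Fin j => Finset.Icc 1 N) with
      StrictMono k ∧ ∀ i : Fin j, k i ≡ (i : ℕ) + 2 [MOD 2],
    ∏ i, (e (k i) : ℤ)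

theorem altForms_zero_right (e : ℕ → ℕ) (N : ℕ) : altForms e N 0 = 1 := by
  simp [altForms, StrictMono, Finset.filter_true_of_mem]

theorem altForms_zero_succ (e : ℕ → ℕ) (j : ℕ) : altForms e 0 (j + 1) = 0 := by
  simp [altForms]

theorem strictMono_snoc_iff {j : ℕ} (k : Fin j → ℕ) (N : ℕ) (h : ∀ i, k i ≤ N) :
    StrictMono (Fin.snoc k (N + 1) : Fin (j + 1) → ℕ) ↔ StrictMono k := by
  constructor
  · intro hk a b hab
    simpa using hk (Fin.castSucc_lt_castSucc_iff.2 hab)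
  · intro hk a b
    refine Fin.lastCases ?_ (fun a => ?_) a <;> refine Fin.lastCases ?_ (fun b => ?_) b
    · simp
    · intro hab
      exact absurd hab (not_lt.2 (Fin.le_last _))
    · intro _
      have := h a
      simp
      omega
    · intro hab
      simpa using hk (Fin.castSucc_lt_castSucc_iff.1 hab)

/-- Forms are split by whether their last index is `N + 1`. That index sits in position `j`, counted
from `0`, whence the parity condition. -/
theorem altForms_succ_succ (e : ℕ → ℕ) (N j : ℕ) :
    altForms e (N + 1) (j + 1) = altForms e N (j + 1) +
      if (N + 1) ≡ j [MOD 2] then (e (N + 1) : ℤ) * altForms e N j else 0 := by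
  classical
  rw [altForms, ← Finset.sum_filter_add_sum_filter_not _ (fun k => k (Fin.last j) ≤ N)]
  congr 1
  · rw [altForms]
    refine Finset.sum_congr ?_ fun _ _ => rfl
    ext k
    simp only [Finset.mem_filter, Fintype.mem_piFinset, Finset.mem_Icc]
    constructor
    · rintro ⟨⟨h1, h2, h3⟩, h4⟩
      exact ⟨fun i => ⟨(h1 i).1, (h2.monotone (Fin.le_last i)).trans h4⟩, h2, h3⟩
    · rintro ⟨h1, h2, h3⟩
      exact ⟨⟨fun i => ⟨(h1 i).1, (h1 i).2.trans (Nat.le_succ N)⟩, h2, h3⟩, (h1 _).2⟩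
  · split_ifs with hpar
    · rw [altForms, Finset.mul_sum]
      symm
      refine Finset.sum_bij (fun k _ => (Fin.snoc k (N + 1) : Fin (j + 1) → ℕ)) ?_ ?_ ?_ ?_
      · intro k hk
        simp only [Finset.mem_filter, Fintype.mem_piFinset, Finset.mem_Icc] at hk ⊢
        refine ⟨⟨fun i => ?_, (strictMono_snoc_iff k N fun i => (hk.1 i).2).2 hk.2.1, fun i => ?_⟩, ?_⟩
        · refine Fin.lastCases ?_ (fun i => ?_) i
          · simp
          · have := hk.1 i
            simp
            omega
        · refine Fin.lastCases ?_ (fun i => ?_) i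
          · simpa [Nat.ModEq] using hpar
          · simpa using hk.2.2 i
        · simp
      · intro k _ k' _ h
        exact (Fin.snoc_injective2 h).1
      · intro k hk
        simp only [Finset.mem_filter, Fintype.mem_piFinset, Finset.mem_Icc] at hk
        obtain ⟨⟨h1, h2, h3⟩, h4⟩ := hk
        have hlast : k (Fin.last j) = N + 1 := by
          have := (h1 (Fin.last j)).2
          omega
        refine ⟨Fin.init k, ?_, ?_⟩
        · simp only [Finset.mem_filter, Fintype.mem_piFinset, Finset.mem_Icc, Fin.init]
          refine ⟨fun i => ⟨(h1 _).1, ?_⟩, fun a b hab => h2 (Fin.castSucc_lt_castSucc_iff.2 hab),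
            fun i => h3 i.castSucc⟩
          have := h2 (Fin.castSucc_lt_last i)
          omega
        · rw [← hlast, Fin.snoc_init_self]
      · intro k _
        simp [Fin.prod_univ_castSucc, mul_comm]
    · refine Finset.sum_eq_zero fun k hk => ?_
      exfalso
      simp only [Finset.mem_filter, Fintype.mem_piFinset, Finset.mem_Icc] at hk
      obtain ⟨⟨h1, h2, h3⟩, h4⟩ := hk
      have hlast : k (Fin.last j) = N + 1 := by
        have := (h1 (Fin.last j)).2
        omega
      have := h3 (Fin.last j)
      rw [hlast] at this
      exact hpar (by simpa [Nat.ModEq] using this)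

theorem altForms_eq_zero (e : ℕ → ℕ) {N j : ℕ} (h : N < j) : altForms e N j = 0 := by
  induction N generalizing j with
  | zero =>
    obtain ⟨j, rfl⟩ := Nat.exists_eq_succ_of_ne_zero h.ne'
    exact altForms_zero_succ e j
  | succ N ih =>
    obtain ⟨j, rfl⟩ := Nat.exists_eq_succ_of_ne_zero (by omega : j ≠ 0)
    rw [altForms_succ_succ, ih (by omega), ih (by omega)]
    simp

/-- The alternating sum of the forms of odd length below `2 * K`. -/
noncomputable def oddForms (e : ℕ → ℕ) (K N : ℕ) : ℤ :=
  ∑ k ∈ Finset.range K, (-1) ^ (k + 1) * altForms e N (2 * k + 1)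

/-- The alternating sum of the forms of even length up to `2 * K`. -/
noncomputable def evenForms (e : ℕ → ℕ) (K N : ℕ) : ℤ :=
  ∑ k ∈ Finset.range (K + 1), (-1) ^ k * altForms e N (2 * k)

theorem oddForms_odd (e : ℕ → ℕ) (K N : ℕ) :
    oddForms e K (2 * N + 1) = oddForms e K (2 * N) := by
  refine Finset.sum_congr rfl fun k _ => ?_
  rw [altForms_succ_succ, if_neg (by unfold Nat.ModEq; omega), add_zero]

theorem evenForms_even (e : ℕ → ℕ) (K N : ℕ) :
    evenForms e K (2 * N + 2) = evenForms e K (2 * N + 1) := by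
  rw [evenForms, evenForms]
  refine Finset.sum_congr rfl fun k _ => ?_
  rcases k with _ | k
  · simp [altForms_zero_right]
  · rw [show 2 * (k + 1) = 2 * k + 1 + 1 by ring, show 2 * N + 2 = 2 * N + 1 + 1 by ring,
      altForms_succ_succ, if_neg (by unfold Nat.ModEq; omega), add_zero]

theorem evenForms_odd (e : ℕ → ℕ) (K N : ℕ) :
    evenForms e K (2 * N + 1) = evenForms e K (2 * N) + e (2 * N + 1) * oddForms e K (2 * N) := by
  rw [evenForms, evenForms, oddForms, Finset.sum_range_succ', Finset.sum_range_succ' _ K,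
    Finset.mul_sum]
  simp only [mul_zero, altForms_zero_right]
  rw [add_right_comm, ← Finset.sum_add_distrib]
  congr 1
  refine Finset.sum_congr rfl fun k _ => ?_
  rw [show 2 * (k + 1) = 2 * k + 1 + 1 by ring, altForms_succ_succ,
    if_pos (by unfold Nat.ModEq; omega)]
  ring

theorem oddForms_even (e : ℕ → ℕ) {K N : ℕ} (h : N < K) :
    oddForms e K (2 * N + 2) =
      oddForms e K (2 * N + 1) - e (2 * N + 2) * evenForms e K (2 * N + 1) := by
  -- The even sum has one term more than the odd ones; its top form has length `2 * K > 2 * N + 1`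
  -- and vanishes.
  rw [evenForms, oddForms, oddForms, Finset.sum_range_succ, altForms_eq_zero e (by omega : _ < 2 * K),
    mul_zero, add_zero, Finset.mul_sum, ← Finset.sum_sub_distrib]
  refine Finset.sum_congr rfl fun k _ => ?_
  rw [show 2 * N + 2 = 2 * N + 1 + 1 by ring, altForms_succ_succ,
    if_pos (by unfold Nat.ModEq; omega)]
  ring

theorem altFormSum_eq_oddForms (r : ℕ) (e : ℕ → ℕ) : altFormSum r e = oddForms e r (2 * r) := by
  rw [altFormSum, oddForms, ← Finset.Ico_add_one_right_eq_Icc, Finset.sum_Ico_eq_sum_range]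
  refine Finset.sum_congr rfl fun k _ => ?_
  rw [add_comm 1 k, show 2 * (k + 1) - 1 = 2 * k + 1 by omega]
  rfl

/-! ### Alternating geometric sums. -/

/-- The polynomial `1 - t + t² - ⋯` with `n` terms. -/
noncomputable def negGeom (n : ℕ) : ℤ[X] := ∑ j ∈ Finset.range n, (-X) ^ j

theorem negGeom_succ (n : ℕ) : negGeom (n + 1) = negGeom n + (-X) ^ n :=
  Finset.sum_range_succ _ _

theorem one_add_X_mul_negGeom (n : ℕ) : (1 + X) * negGeom n = 1 - (-X) ^ n := by
  have := mul_neg_geom_sum (-X : ℤ[X]) n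
  rwa [sub_neg_eq_add] at this

theorem negGeom_add (m n : ℕ) : negGeom (m + n) = negGeom m + (-X) ^ m * negGeom n := by
  rw [negGeom, Finset.sum_range_add, negGeom, negGeom, Finset.mul_sum]
  simp only [pow_add]

theorem natDegree_neg_X_pow_le (n : ℕ) : ((-X : ℤ[X]) ^ n).natDegree ≤ n := by
  refine natDegree_pow_le.trans ?_
  simp

theorem natDegree_negGeom_le (n : ℕ) : (negGeom n).natDegree ≤ n - 1 :=
  natDegree_sum_le_of_forall_le _ _ fun j hj =>
    (natDegree_neg_X_pow_le j).trans (by have := Finset.mem_range.1 hj; omega)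

theorem eval_neg_one_negGeom (n : ℕ) : (negGeom n).eval (-1) = n := by
  simp [negGeom, eval_finsetSum]

theorem altPoly_coeff (m i : ℕ) :
    (altPoly m).coeff i = if i < m then (-1) ^ (m - 1 - i) else 0 := by
  have : altPoly m = ∑ j ∈ Finset.range m, Polynomial.C ((-1) ^ (m - 1 - j)) * X ^ j := by
    rw [altPoly, ← Finset.sum_range_reflect]
    refine Finset.sum_congr rfl fun j hj => ?_
    have := Finset.mem_range.1 hj
    rw [show m - 1 - (m - 1 - j) = j by omega]
    simp
  rw [this, finsetSum_coeff]
  simp only [coeff_C_mul, coeff_X_pow]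
  simp

theorem altPoly_succ (k : ℕ) : altPoly (k + 1) = (-1) ^ k * negGeom (k + 1) := by
  rw [altPoly, ← Finset.sum_range_reflect, negGeom, Finset.mul_sum]
  refine Finset.sum_congr rfl fun j hj => ?_
  have hj := Finset.mem_range.1 hj
  obtain ⟨i, rfl⟩ := Nat.exists_eq_add_of_le (Nat.lt_succ_iff.1 hj)
  rw [show j + i + 1 - 1 - (j + i + 1 - 1 - j) = j by omega,
    show j + i + 1 - 1 - j = i by omega, neg_pow (X : ℤ[X]) j, ← mul_assoc, ← pow_add,
    show j + i + j = i + 2 * j by ring, pow_add, pow_mul]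
  simp

/-! ### Burau matrices of the words: dependence on `e₁`, degrees, value at `t = -1`. -/

namespace BraidWord

theorem burauGen_zero_pow (n : ℕ) : burauGen 0 ^ n = !![(-X) ^ n, negGeom n; 0, 1] := by
  induction n with
  | zero => simp [negGeom, Matrix.one_fin_two]
  | succ n ih =>
    rw [pow_succ, ih, burauGen, if_pos rfl, Matrix.mul_fin_two, negGeom_succ, pow_succ]
    simp [add_comm]

theorem burauGen_one_pow (n : ℕ) : burauGen 1 ^ n = !![1, 0; X * negGeom n, (-X) ^ n] := by
  induction n with
  | zero => simp [negGeom, Matrix.one_fin_two]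
  | succ n ih =>
    rw [pow_succ, ih, burauGen, if_neg (by decide), Matrix.mul_fin_two, negGeom_succ, pow_succ]
    simp [add_mul, mul_comm X]

theorem burau_threeBraid_succ (r : ℕ) (e : ℕ → ℕ) :
    burau (threeBraid (r + 1) e) =
      burau (threeBraid r e) * burauGen 0 ^ e (2 * r + 1) * burauGen 1 ^ e (2 * r + 2) := by
  simp [burau, threeBraid, List.range_succ, List.prod_append, mul_assoc]

theorem burau_threeBraid_update (e : ℕ → ℕ) (a : ℕ) {r : ℕ} (hr : 1 ≤ r) :
    burau (threeBraid r (Function.update e 1 a)) =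
      burauGen 0 ^ a * burau (threeBraid r (Function.update e 1 0)) := by
  induction r, hr using Nat.le_induction with
  | base => simp [threeBraid, burau]
  | succ r hr ih =>
    rw [burau_threeBraid_succ, ih, burau_threeBraid_succ]
    have h (b : ℕ) : Function.update e 1 b (2 * r + 1) = e (2 * r + 1) :=
      Function.update_of_ne (by omega) _ _
    have h' (b : ℕ) : Function.update e 1 b (2 * r + 2) = e (2 * r + 2) :=
      Function.update_of_ne (by omega) _ _
    simp only [h, h', mul_assoc]

theorem burau_threeBraid_succ_apply (r : ℕ) (e : ℕ → ℕ) (i : Fin 2) :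
    burau (threeBraid (r + 1) e) i 0 = burau (threeBraid r e) i 0 * (-X) ^ e (2 * r + 1) +
      (burau (threeBraid r e) i 0 * negGeom (e (2 * r + 1)) + burau (threeBraid r e) i 1) *
        (X * negGeom (e (2 * r + 2))) ∧
    burau (threeBraid (r + 1) e) i 1 = (burau (threeBraid r e) i 0 * negGeom (e (2 * r + 1)) +
        burau (threeBraid r e) i 1) * (-X) ^ e (2 * r + 2) := by
  rw [burau_threeBraid_succ, burauGen_zero_pow, burauGen_one_pow]
  simp [Matrix.mul_apply, Fin.sum_univ_two]

theorem X_dvd_burau_threeBraid_succ (r : ℕ) (e : ℕ → ℕ) (h : 1 ≤ e (2 * r + 1)) (i : Fin 2) :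
    X ∣ burau (threeBraid (r + 1) e) i 0 := by
  rw [(burau_threeBraid_succ_apply r e i).1]
  refine dvd_add (Dvd.dvd.mul_left ?_ _) ((dvd_mul_right _ _).mul_left _)
  exact (dvd_neg.2 dvd_rfl).trans (dvd_pow_self (-X) (by omega))

/-- One degree is lost against the exponent sum because `negGeom n` has degree only `n - 1`; both
new exponents must be positive for this. -/
theorem natDegree_burau_threeBraid_succ_le (r : ℕ) (e : ℕ → ℕ) (h1 : 1 ≤ e (2 * r + 1))
    (h2 : 1 ≤ e (2 * r + 2)) (i : Fin 2) (d : ℕ)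
    (hd : ∀ j, (burau (threeBraid r e) i j).natDegree ≤ d) (j : Fin 2) :
    (burau (threeBraid (r + 1) e) i j).natDegree + 1 ≤ d + e (2 * r + 1) + e (2 * r + 2) := by
  have hb : (burau (threeBraid r e) i 0 * negGeom (e (2 * r + 1)) +
      burau (threeBraid r e) i 1).natDegree ≤ d + (e (2 * r + 1) - 1) :=
    natDegree_add_le_of_degree_le
      (natDegree_mul_le_of_le (hd 0) (natDegree_negGeom_le _)) ((hd 1).trans (by omega))
  obtain ⟨h0, h1'⟩ := burau_threeBraid_succ_apply r e i
  match j with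
  | 0 =>
    rw [h0]
    have : (burau (threeBraid r e) i 0 * (-X) ^ e (2 * r + 1) +
      (burau (threeBraid r e) i 0 * negGeom (e (2 * r + 1)) + burau (threeBraid r e) i 1) *
        (X * negGeom (e (2 * r + 2)))).natDegree ≤ d + e (2 * r + 1) + e (2 * r + 2) - 1 :=
      natDegree_add_le_of_degree_le
        ((natDegree_mul_le_of_le (hd 0) (natDegree_neg_X_pow_le _)).trans (by omega))
        ((natDegree_mul_le_of_le hb
          (natDegree_mul_le_of_le natDegree_X_le (natDegree_negGeom_le _))).trans (by omega))
    omega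
  | 1 =>
    rw [h1']
    have := natDegree_mul_le_of_le hb (natDegree_neg_X_pow_le (e (2 * r + 2)))
    omega

/-- At `t = -1` the powers become `[[1, n], [0, 1]]` and `[[1, 0], [-n, 1]]`. Acting on the row `(0,
1)`, they reproduce the recursions of the odd and even form sums. -/
theorem eval_neg_one_burau_threeBraid (e : ℕ → ℕ) (K r : ℕ) (h : r ≤ K) :
    (burau (threeBraid r e) 1 0).eval (-1) = oddForms e K (2 * r) ∧
      (burau (threeBraid r e) 1 1).eval (-1) = evenForms e K (2 * r) := by
  induction r with
  | zero =>
    have hodd : oddForms e K 0 = 0 :=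
      Finset.sum_eq_zero fun k _ => by rw [altForms_zero_succ, mul_zero]
    have heven : evenForms e K 0 = 1 := by
      rw [evenForms, Finset.sum_range_succ', Finset.sum_eq_zero fun k _ => ?_]
      · simp [altForms_zero_right]
      · rw [altForms_eq_zero e (by omega), mul_zero]
    simp [threeBraid, burau, hodd, heven]
  | succ r ih =>
    obtain ⟨h0, h1⟩ := ih (by omega)
    rw [(burau_threeBraid_succ_apply r e 1).1, (burau_threeBraid_succ_apply r e 1).2,
      show 2 * (r + 1) = 2 * r + 2 by ring, evenForms_even, oddForms_even e (by omega : r < K),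
      oddForms_odd, evenForms_odd]
    simp only [eval_add, eval_mul, eval_pow, eval_neg, eval_X, eval_neg_one_negGeom, h0, h1,
      neg_neg, one_pow]
    constructor <;> ring

/-- A left factor `burauGen 0 ^ a` leaves the bottom row unchanged, so the form sum does not involve
`e₁`. -/
theorem altFormSum_eq_eval_burau (e : ℕ → ℕ) (a : ℕ) {r : ℕ} (hr : 1 ≤ r) :
    altFormSum r (Function.update e 1 a) =
      (burau (threeBraid r (Function.update e 1 0)) 1 0).eval (-1) := by
  rw [altFormSum_eq_oddForms, ← (eval_neg_one_burau_threeBraid _ r r le_rfl).1,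
    burau_threeBraid_update e a hr, burauGen_zero_pow]
  simp [Matrix.mul_apply, Fin.sum_univ_two]

end BraidWord

/-! ### Exponent sums and degree bounds. -/

theorem wStar_succ {r : ℕ} (hr : 1 ≤ r) (e : ℕ → ℕ) :
    wStar (r + 1) e = wStar r e + e (2 * r + 1) + e (2 * r + 2) := by
  unfold wStar
  rw [show 2 * (r + 1) = 2 * r + 1 + 1 by ring, Finset.sum_Icc_succ_top (by omega),
    Finset.sum_Icc_succ_top (by omega)]

theorem wStar_one (e : ℕ → ℕ) : wStar 1 e = e 2 := by simp [wStar]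

theorem wStar_update (r : ℕ) (e : ℕ → ℕ) (a : ℕ) : wStar r (Function.update e 1 a) = wStar r e := by
  refine Finset.sum_congr rfl fun k hk => Function.update_of_ne ?_ _ _
  have := (Finset.mem_Icc.1 hk).1
  omega

theorem positive_threeBraid (r : ℕ) (e : ℕ → ℕ) : ∀ x ∈ threeBraid r e, x.2 = 1 := by
  intro x hx
  simp only [threeBraid, List.mem_flatMap, List.mem_append, List.mem_replicate] at hx
  obtain ⟨_, _, ⟨_, rfl⟩ | ⟨_, rfl⟩⟩ := hx <;> rfl

theorem length_threeBraid_update {r : ℕ} (hr : 1 ≤ r) (e : ℕ → ℕ) (a : ℕ) :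
    (threeBraid r (Function.update e 1 a)).length = a + wStar r e := by
  have h := writhe_threeBraid r hr (Function.update e 1 a)
  rw [BraidWord.writhe_of_positive _ (positive_threeBraid _ _), wStar_update,
    Function.update_self] at h
  omega

/-- Degree bounds for the rows of the Burau matrix of a word whose first exponent is zero. -/
theorem natDegree_burau_update_le (e : ℕ → ℕ) {r : ℕ} (hr : 2 ≤ r)
    (he : ∀ k ∈ Finset.Icc 2 (2 * r), 1 ≤ e k) (i : Fin 2) (c : ℕ)
    (hc : ∀ j, (BraidWord.burau (threeBraid 1 (Function.update e 1 0)) i j).natDegree + c ≤ e 2)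
    (j : Fin 2) :
    (BraidWord.burau (threeBraid r (Function.update e 1 0)) i j).natDegree + c + 1 ≤ wStar r e := by
  -- Each further pair of syllables gains a degree of slack beyond `c`; `2 ≤ r` provides at least
  -- one such pair.
  have step (r : ℕ) (hr : 1 ≤ r) (he : ∀ k ∈ Finset.Icc 2 (2 * (r + 1)), 1 ≤ e k)
      (h : ∀ j, (BraidWord.burau (threeBraid r (Function.update e 1 0)) i j).natDegree + c ≤
        wStar r e) (j : Fin 2) :
      (BraidWord.burau (threeBraid (r + 1) (Function.update e 1 0)) i j).natDegree + c + 1 ≤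
        wStar (r + 1) e := by
    have h1 : Function.update e 1 0 (2 * r + 1) = e (2 * r + 1) :=
      Function.update_of_ne (by omega) _ _
    have h2 : Function.update e 1 0 (2 * r + 2) = e (2 * r + 2) :=
      Function.update_of_ne (by omega) _ _
    have := BraidWord.natDegree_burau_threeBraid_succ_le r (Function.update e 1 0)
      (by rw [h1]; exact he _ (Finset.mem_Icc.2 (by omega)))
      (by rw [h2]; exact he _ (Finset.mem_Icc.2 (by omega))) i (wStar r e - c)
      (fun j => by have := h j; omega) j
    rw [h1, h2] at this
    have := h j
    rw [wStar_succ hr]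
    omega
  induction r, hr using Nat.le_induction generalizing j with
  | base => exact step 1 le_rfl he (by simpa [wStar_one] using hc) j
  | succ r hr ih =>
    refine step r (by omega) he (fun j => ?_) j
    have := ih (fun k hk => he k (Finset.mem_Icc.2 (by have := Finset.mem_Icc.1 hk; omega))) j
    omega

theorem natDegree_add_one_le_of_monic_mul {f g : ℤ[X]} (hf : f.Monic) (hf1 : f.natDegree = 1)
    {d : ℕ} (hd : 1 ≤ d) (h : (f * g).natDegree ≤ d) : g.natDegree + 1 ≤ d := by
  by_cases hg : g = 0
  · simpa [hg] using hd
  · rw [hf.natDegree_mul' hg, hf1] at h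
    omega

/-! ### Separation of the two blocks and the gap. -/

theorem mainTheorem4 (r : ℕ) (hr : 2 ≤ r) (e : ℕ → ℕ)
    (he : ∀ k ∈ Finset.Icc 2 (2 * r), 1 ≤ e k) :
    ∃ (B₁ : ZMod 2 → ℤ[X]) (B₂ : ℤ[X]) (c : ℕ → ℤ),
      (∀ p, (B₁ p).natDegree ≤ wStar r e) ∧
      B₂.natDegree + 3 ≤ wStar r e ∧
      ∀ a : ℕ, wStar r e ≤ a →
        (threeBraid r (Function.update e 1 a)).vStar =
          inT (B₁ (a : ZMod 2) + X ^ (wStar r e + 1) * gapPoly r (Function.update e 1 a)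
            + X ^ (a + 2) * B₂) ∧
        (∀ j ≤ a - wStar r e,
          (gapPoly r (Function.update e 1 a)).coeff (a - wStar r e - j) = c j ∧
          |c j| = |altFormSum r (Function.update e 1 a)|) ∧
        ∀ j, a - wStar r e < j → (gapPoly r (Function.update e 1 a)).coeff j = 0 := by
  set Q := BraidWord.burau (threeBraid r (Function.update e 1 0)) with hQ
  set W := wStar r e with hW
  set R : ℤ := (Q 1 0).eval (-1) with hR
  have hone : BraidWord.burau (threeBraid 1 (Function.update e 1 0)) =
      !![1, 0; X * negGeom (e 2), (-X) ^ e 2] := by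
    rw [BraidWord.burau_threeBraid_succ, BraidWord.burauGen_zero_pow, BraidWord.burauGen_one_pow]
    simp [threeBraid, BraidWord.burau, negGeom]
  have he2 : 1 ≤ e 2 := he 2 (Finset.mem_Icc.2 (by omega))
  -- The top row of the matrix of `σ₂^{e₂}` is `(1, 0)`, so the slack there is all of `e 2`.
  have hrow0 (j : Fin 2) : (Q 0 j).natDegree + e 2 + 1 ≤ W := by
    refine natDegree_burau_update_le e hr he 0 (e 2) (fun j => ?_) j
    rw [hone]
    fin_cases j <;> simp
  have hrow1 (j : Fin 2) : (Q 1 j).natDegree + 0 + 1 ≤ W := by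
    refine natDegree_burau_update_le e hr he 1 0 (fun j => ?_) j
    rw [hone]
    match j with
    | 0 =>
      have := natDegree_mul_le_of_le (natDegree_X_le (R := ℤ)) (natDegree_negGeom_le (e 2))
      exact this.trans (by omega)
    | 1 => exact natDegree_neg_X_pow_le (e 2)
  have hW3 : 3 ≤ W := by
    have h : ∑ k ∈ Finset.Icc 2 4, e k ≤ W :=
      Finset.sum_le_sum_of_subset (Finset.Icc_subset_Icc_right (by omega))
    have h' : ∑ k ∈ Finset.Icc 2 4, 1 ≤ ∑ k ∈ Finset.Icc 2 4, e k :=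
      Finset.sum_le_sum fun k hk => he k (Finset.Icc_subset_Icc_right (by omega) hk)
    simpa using h'.trans h
  have hX (i : Fin 2) : X ∣ Q i 0 := by
    obtain ⟨r, rfl⟩ := Nat.exists_eq_add_of_le hr
    rw [hQ, show 2 + r = r + 1 + 1 by ring]
    refine BraidWord.X_dvd_burau_threeBraid_succ _ _ ?_ i
    rw [Function.update_of_ne (by omega)]
    exact he _ (Finset.mem_Icc.2 (by omega))
  -- Adding `R * X` kills the value at `-1`; using a multiple of `X` instead of a constant keeps
  -- divisibility by `X`, which passes to `v`.
  obtain ⟨v, hv⟩ : X - Polynomial.C (-1) ∣ Q 1 0 + Polynomial.C R * X := by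
    rw [dvd_iff_isRoot]
    simp [hR]
  have hvdeg : v.natDegree + 1 ≤ W - 1 := by
    refine natDegree_add_one_le_of_monic_mul (monic_X_sub_C (-1)) (natDegree_X_sub_C _) (by omega) ?_
    rw [← hv]
    refine natDegree_add_le_of_degree_le ?_ ((natDegree_C_mul_le _ _).trans (natDegree_X_le.trans (by omega)))
    have := hrow1 0
    omega
  have hXv : X ∣ v := by
    have h : X ∣ (X - Polynomial.C (-1)) * v := hv ▸ dvd_add (hX 1) (dvd_mul_left _ _)
    rw [X_dvd_iff, mul_coeff_zero] at h
    rw [X_dvd_iff]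
    simpa using h
  -- This extra factor `X` produces both the exponent `a + 2` of the high block and its degree bound
  -- `W - 3`.
  obtain ⟨B, hB⟩ : X ∣ Q 0 0 - v := dvd_sub (hX 0) hXv
  have hBdeg : B.natDegree + 1 ≤ W - 2 := by
    refine natDegree_add_one_le_of_monic_mul monic_X natDegree_X (by omega) ?_
    rw [← hB]
    have := hrow0 0
    exact natDegree_sub_le_of_le (by omega : _ ≤ W - 2) (by omega : _ ≤ W - 2) |>.trans (by simp)
  -- The low block collects the terms free of `(-X) ^ a` and the first `W - 1` terms of the
  -- geometric sum, which after multiplication by `X ^ 2` end exactly in degree `W`. Its overall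
  -- sign is the only dependence on `a`.
  refine ⟨fun p => Polynomial.C ((-1) ^ (p.val + W)) *
      (X * v - Polynomial.C R * (X ^ 2 * negGeom (W - 1)) + X * Q 1 1 + X ^ 2 + 1),
    Polynomial.C ((-1) ^ W) * B, fun j => (-1) ^ W * R * (-1) ^ j, fun p => ?_, ?_,
    fun a ha => ⟨?_, ?_, ?_⟩⟩
  · refine (natDegree_C_mul_le _ _).trans ?_
    have h11 := hrow1 1
    refine natDegree_add_le_of_degree_le (natDegree_add_le_of_degree_le
      (natDegree_add_le_of_degree_le ((natDegree_sub_le_of_le (m := W) (n := W) ?_ ?_).trans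
        (by simp)) ?_) ?_) ?_
    · exact (natDegree_mul_le_of_le natDegree_X_le le_rfl).trans (by omega)
    · refine (natDegree_C_mul_le _ _).trans ?_
      exact (natDegree_mul_le_of_le (natDegree_X_pow_le 2) (natDegree_negGeom_le _)).trans
        (by omega)
    · exact (natDegree_mul_le_of_le natDegree_X_le le_rfl).trans (by omega)
    · exact (natDegree_X_pow_le 2).trans (by omega)
    · simp
  · have := natDegree_C_mul_le ((-1) ^ W) B
    omega
  · rw [BraidWord.vStar_of_positive _ (positive_threeBraid _ _),
      length_threeBraid_update (by omega), BraidWord.burau_threeBraid_update e a (by omega), ← hQ,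
      ← hW, gapPoly, wStar_update, ← hW, Function.update_self,
      BraidWord.altFormSum_eq_eval_burau e a (by omega), ← hQ, ← hR]
    congr 1
    have htr : (BraidWord.burauGen 0 ^ a * Q).trace =
        (-X) ^ a * Q 0 0 + negGeom a * Q 1 0 + Q 1 1 := by
      rw [BraidWord.burauGen_zero_pow, Matrix.trace_fin_two, Matrix.mul_apply, Matrix.mul_apply,
        Fin.sum_univ_two, Fin.sum_univ_two]
      simp
    have hsign : ((-1) ^ ((a : ZMod 2).val + W) : ℤ) = (-1) ^ (a + W) := by
      rw [ZMod.val_natCast, pow_add, pow_add, ← neg_one_pow_eq_pow_mod_two]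
    have hga := one_add_X_mul_negGeom a
    obtain ⟨n, hn⟩ : ∃ n, W = n + 1 := ⟨W - 1, by omega⟩
    obtain ⟨k, rfl⟩ := Nat.exists_eq_add_of_le ha
    -- The cut between low block and gap: `n = W - 1` terms below, `k + 1 = a + 1 - W` terms above.
    have hsum : negGeom (W + k) = negGeom n + (-X) ^ n * negGeom (k + 1) := by
      rw [← negGeom_add, hn]
      congr 1
      omega
    have hv' : Q 1 0 = (1 + X) * v - Polynomial.C R * X := by
      rw [eq_sub_iff_add_eq, hv]
      simp [add_comm]
    have hB' : Q 0 0 = v + X * B := by rw [← hB]; ring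
    beta_reduce
    rw [htr, hsign, show W + k + 1 - W = k + 1 by omega, altPoly_succ,
      show W - 1 = n by omega]
    have hσ : ((-1) ^ (W + k + W) : ℤ[X]) = (-1) ^ k := by
      rw [show W + k + W = k + 2 * W by ring, pow_add, pow_mul]
      simp
    have hτ : ((-1) ^ k * (-X) ^ (W + k) : ℤ[X]) = (-1) ^ W * X ^ (W + k) := by
      rw [neg_pow (X : ℤ[X]), pow_add, ← mul_assoc, mul_left_comm, ← mul_pow]
      simp
    have hν : ((-1) ^ W * X ^ (W + 1) : ℤ[X]) = -(X ^ 2 * (-X) ^ n) := by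
      rw [neg_pow (X : ℤ[X]) n, hn]
      ring
    simp only [map_mul, map_pow, map_neg, map_one, hσ]
    rw [hv', hB']
    -- `hga` cancels `1 + X` against the geometric sum, `hsum` cuts off the gap, and `hτ` and `hν`
    -- match the signs of the high block and of the gap.
    linear_combination (-1) ^ k * X * v * hga - (-1) ^ k * X ^ 2 * Polynomial.C R * hsum
      + X ^ 2 * B * hτ - (-1) ^ k * Polynomial.C R * negGeom (k + 1) * hν
  · intro j hj
    rw [gapPoly, wStar_update, ← hW, Function.update_self,
      BraidWord.altFormSum_eq_eval_burau e a (by omega), ← hQ, ← hR, coeff_C_mul, altPoly_coeff,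
      if_pos (by omega), show a + 1 - W - 1 - (a - W - j) = j by omega]
    simp [abs_mul]
  · intro j hj
    rw [gapPoly, wStar_update, ← hW, Function.update_self, coeff_C_mul, altPoly_coeff,
      if_neg (by omega), mul_zero]
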